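/- Let $\Sigma=\{R^2,E^2\}\cup\{P^n_m\mid n,m\in\mathbb N,\ n,m\ge 1\}$ be a relational vocabulary (upper index = arity). A formula is a first-order formula with identity over $\Sigma$; $\varphi(x,\bar w_n)$ means that $x,w_1,\dots,w_n$ are distinct variables ($n\ge 0$) among which are all free variables of $\varphi$. $\Theta$ ranges over the subsets of $\Sigma$ that contain $R$ and $E$. *Standard translation.* Fix a vocabulary of intuitionistic predicate letters ($0$-ary ones allowed) and a map $P\mapsto P'$ that sends each $n$-ary intuitionistic letter ($n\ge0$) to an $(n+1)$-ary letter of $\Sigma\setminus\{R,E\}$ and is onto $\Sigma\setminus\{R,E\}$. For intuitionistic predicate formulas $i(\bar w_n)$ without identity (built from atoms and $\bot$ by $\wedge,\vee,\to,\exists,\forall$), the standard $x$-translation is defined, with the usual conventions on fresh variables, by $ST(P(w_{j_1},\dots,w_{j_k}),x)=P'(x,w_{j_1},\dots,w_{j_k})$; $ST(\bot,x)=(x\ne x)$; $ST(i\wedge j,x)=ST(i,x)\wedge ST(j,x)$; $ST(i\vee j,x)=ST(i,x)\vee ST(j,x)$; $ST(i\to j,x)=\forall y(R(x,y)\to(ST(i,y)\to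 ST(j,y)))$; $ST(\exists w'\,i,x)=\exists w'(E(x,w')\wedge ST(i,x))$; $ST(\forall w'\,i,x)=\forall y\forall w'((R(x,y)\wedge E(y,w'))\to ST(i,y))$. *Asimulations.* An $n$-ary evaluation $\Theta$-point $(M,a,\bar b_n)$ is a $\Theta$-model $M$ with elements $a,b_1,\dots,b_n$ of its domain $D(M)$. Let $(M,a,\bar b_n)$, $(N,c,\bar d_n)$ be $n$-ary evaluation $\Theta$-points, with $D(M)$ and $D(N)$ taken disjoint. A relation $$A\subseteq\bigcup_{l\ge0}\Big(\big((D(M)\times D(M)^l)\times(D(N)\times D(N)^l)\big)\cup\big((D(N)\times D(N)^l)\times(D(M)\times D(M)^l)\big)\Big)$$ is a $\langle(M,a,\bar b_n),(N,c,\bar d_n)\rangle$-asimulation iff $(a;\bar b_n)\,A\,(c;\bar d_n)$ and, for all $\alpha,\beta\in\{M,N\}$, all $l\ge 0$, and all $(a';\bar b'_l)\in D(\alpha)\times D(\alpha)^l$, $(c';\bar d'_l)\in D(\beta)\times D(\beta)^l$ with $(a';\bar b'_l)\,A\,(c';\bar d'_l)$: 1. for every $(k+1)$-ary $P\in\Theta\setminus\{R,E\}$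 ($k\ge 0$) and all $j_1,\dots,j_k\in\{1,\dots,l\}$, if $P^\alpha(a',b'_{j_1},\dots,b'_{j_k})$ then $P^\beta(c',d'_{j_1},\dots,d'_{j_k})$; 2. if $c'R^\beta c''$, then there is $a''\in D(\alpha)$ with $a'R^\alpha a''$, $(c'';\bar d'_l)\,A\,(a'';\bar b'_l)$ and $(a'';\bar b'_l)\,A\,(c'';\bar d'_l)$; 3. if $E^\alpha(a',b'')$, then there is $d''\in D(\beta)$ with $E^\beta(c',d'')$ and $(a';\bar b'_l,b'')\,A\,(c';\bar d'_l,d'')$; 4. if $c'R^\beta c''$ and $E^\beta(c'',d'')$, then there are $a'',b''\in D(\alpha)$ with $a'R^\alpha a''$, $E^\alpha(a'',b'')$ and $(a'';\bar b'_l,b'')\,A\,(c'';\bar d'_l,d'')$. A formula $\varphi(x,\bar w_n)$ is invariant with respect to asimulations iff, for every $\Theta$ that contains all predicate letters of $\varphi$ and all $n$-ary evaluation $\Theta$-points $(M,a,\bar b_n)$, $(N,c,\bar d_n)$ such that a $\langle(M,a,\bar b_n),(N,c,\bar d_n)\rangle$-asimulation exists, $M,a,\bar b_n\models\varphi(x,\bar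 w_n)$ implies $N,c,\bar d_n\models\varphi(x,\bar w_n)$. **Theorem.** A formula $\varphi(x,\bar w_n)$ is invariant with respect to asimulations if and only if it is logically equivalent (over all first-order models) to the standard $x$-translation $ST(i(\bar w_n),x)$ of some intuitionistic predicate formula $i(\bar w_n)$ without identity. -/

import Mathlib

open scoped FirstOrder

universe u v

namespace Asim

/-- The predicate letters, by arity, of a vocabulary `Θ` with `{R, E} ⊆ Θ ⊆ Σ`, where
`Σ = {R, E} ∪ {P^{k+1}_m}`: the binary letters `R` and `E` always belong to it, and `P^{k+1}_m`
(of arity `k + 1 ≥ 1`) belongs to it iff `(k, m) ∈ Θ`. -/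
inductive Letter (Θ : Set (ℕ × ℕ)) : ℕ → Type
  | R : Letter Θ 2
  | E : Letter Θ 2
  | P (k m : ℕ) (h : (k, m) ∈ Θ) : Letter Θ (k + 1)

/-- The purely relational first-order language (with identity) on the vocabulary `Θ`. -/
abbrev Voc (Θ : Set (ℕ × ℕ)) : FirstOrder.Language.{0, 0} where
  Functions := fun _ => Empty
  Relations := Letter Θ

/-- The language of the full vocabulary `Σ`. -/
abbrev FullVoc : FirstOrder.Language.{0, 0} := Voc Set.univ

/-- The inclusion of a vocabulary `Θ` in the full vocabulary `Σ`. -/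
def incl (Θ : Set (ℕ × ℕ)) : Voc Θ →ᴸ FullVoc where
  onFunction := fun _ f => f
  onRelation := fun _ r =>
    match r with
    | .R => .R
    | .E => .E
    | .P k m _ => .P k m (Set.mem_univ _)

/-- Formulas `i(w₁, …, wₙ)` of intuitionistic predicate logic without identity, with free
variables among `w₁, …, wₙ`, in a vocabulary with `I k` as its set of `k`-ary predicate letters
(`0`-ary letters are allowed). A quantifier binds the last variable `wₙ₊₁` of its body. -/
inductive IFormula (I : ℕ → Type v) : ℕ → Type v
  | atom {n k : ℕ} (p : I k) (t : Fin k → Fin n) : IFormula I n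
  | bot {n : ℕ} : IFormula I n
  | and {n : ℕ} (i j : IFormula I n) : IFormula I n
  | or {n : ℕ} (i j : IFormula I n) : IFormula I n
  | imp {n : ℕ} (i j : IFormula I n) : IFormula I n
  | ex {n : ℕ} (i : IFormula I (n + 1)) : IFormula I n
  | all {n : ℕ} (i : IFormula I (n + 1)) : IFormula I n

section Translation

variable {α : Type} {m : ℕ}

/-- A variable (free, or bound by one of the `m` quantifiers around) under one more quantifier. -/
def up (s : α ⊕ Fin m) : α ⊕ Fin (m + 1) := Sum.map id Fin.castSucc s

/-- The variable bound by the innermost of `m + 1` quantifiers. -/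
def new : α ⊕ Fin (m + 1) := Sum.inr (Fin.last m)

/-- The atomic formula `R(s, t)`. -/
def relR (s t : α ⊕ Fin m) : FullVoc.BoundedFormula α m :=
  FirstOrder.Language.Relations.boundedFormula₂ (L := FullVoc) Letter.R (.var s) (.var t)

/-- The atomic formula `E(s, t)`. -/
def relE (s t : α ⊕ Fin m) : FullVoc.BoundedFormula α m :=
  FirstOrder.Language.Relations.boundedFormula₂ (L := FullVoc) Letter.E (.var s) (.var t)

/-- The atomic formula `P^{k+1}_q(s, t₁, …, tₖ)`. -/
def relP (k q : ℕ) (s : α ⊕ Fin m) (t : Fin k → α ⊕ Fin m) : FullVoc.BoundedFormula α m :=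
  FirstOrder.Language.Relations.boundedFormula (L := FullVoc) (Letter.P k q (Set.mem_univ _))
    (fun j => .var ((Fin.cons s t : Fin (k + 1) → α ⊕ Fin m) j))

end Translation

/-- The standard translation `ST(i(w₁, …, wₙ), x)`, for any variables `x`, `w₁, …, wₙ` in the
scope of `m` quantifiers; the `k`-ary intuitionistic letter `p` goes to `P^{k+1}_{tr k p}`. -/
def ST {I : ℕ → Type v} (tr : ∀ k, I k → ℕ) {α : Type} :
    ∀ {n m : ℕ}, IFormula I n → (x : α ⊕ Fin m) → (w : Fin n → α ⊕ Fin m) →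
      FullVoc.BoundedFormula α m
  | _, _, .atom (k := k) p t, x, w => relP k (tr k p) x (fun j => w (t j))
  | _, _, .bot, x, _ => ∼((FirstOrder.Language.Term.var x).bdEqual (FirstOrder.Language.Term.var x))
  | _, _, .and i j, x, w => ST tr i x w ⊓ ST tr j x w
  | _, _, .or i j, x, w => ST tr i x w ⊔ ST tr j x w
  | _, _, .imp i j, x, w =>
      ∀' (relR (up x) new ⟹
        (ST tr i new (fun l => up (w l)) ⟹ ST tr j new (fun l => up (w l))))
  | n, _, .ex i, x, w =>
      ∃' (relE (up x) new ⊓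
        ST tr i (up x) (Fin.snoc (α := fun _ : Fin (n + 1) => _) (fun l => up (w l)) new))
  | n, _, .all i, x, w =>
      ∀' ∀' ((relR (up (up x)) (up new) ⊓ relE (up new) new) ⟹
        ST tr i (up new)
          (Fin.snoc (α := fun _ : Fin (n + 1) => _) (fun l => up (up (w l))) new))

/-- The standard `x`-translation of `i(w₁, …, wₙ)` as a formula in the free variables
`x, w₁, …, wₙ`, which are numbered `0, 1, …, n`. -/
def stdTranslation {I : ℕ → Type v} (tr : ∀ k, I k → ℕ) {n : ℕ} (i : IFormula I n) :
    FullVoc.Formula (Fin (n + 1)) :=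
  ST tr (m := 0) i (Sum.inl 0) (fun l => Sum.inl l.succ)

section Asimulation

variable {Θ : Set (ℕ × ℕ)}

/-- `a R b` in the `Θ`-model `M`. -/
def HoldsR (Θ : Set (ℕ × ℕ)) {M : Type u} [(Voc Θ).Structure M] (a b : M) : Prop :=
  FirstOrder.Language.Structure.RelMap (L := Voc Θ) Letter.R ![a, b]

/-- `E(a, b)` in the `Θ`-model `M`. -/
def HoldsE (Θ : Set (ℕ × ℕ)) {M : Type u} [(Voc Θ).Structure M] (a b : M) : Prop :=
  FirstOrder.Language.Structure.RelMap (L := Voc Θ) Letter.E ![a, b]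

/-- `P^{k+1}_q(a, b₁, …, bₖ)` in the `Θ`-model `M`, where `P^{k+1}_q` belongs to `Θ`. -/
def HoldsP {M : Type u} [(Voc Θ).Structure M] {k q : ℕ} (h : (k, q) ∈ Θ) (a : M)
    (b : Fin k → M) : Prop :=
  FirstOrder.Language.Structure.RelMap (L := Voc Θ) (Letter.P k q h) (Fin.cons a b : Fin (k + 1) → M)

/-- Relations between tuples `(a; b₁, …, bₗ)` in `M` and tuples `(c; d₁, …, dₗ)` in `N`, of any
common length `l ≥ 0`. -/
abbrev TupleRel (M N : Type u) : Type u :=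
  ∀ l : ℕ, M → (Fin l → M) → N → (Fin l → N) → Prop

/-- The four conditions on the pairs that lead from `M` to `N`. An asimulation between `M` and
`N`, whose domains are kept disjoint, is a relation that consists of a part `A` from tuples of `M`
to tuples of `N` and a part `B` from tuples of `N` to tuples of `M`. -/
structure AsimConditions (Θ : Set (ℕ × ℕ)) {M N : Type u} [(Voc Θ).Structure M]
    [(Voc Θ).Structure N] (A : TupleRel M N) (B : TupleRel N M) : Prop where
  /-- Every atom `P(x, w_{f 1}, …, w_{f k})` in the variables `x, w₁, …, wₗ` with `P ∈ Θ` other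
  than `R`, `E` is preserved. -/
  atoms : ∀ {l : ℕ} {a : M} {b : Fin l → M} {c : N} {d : Fin l → N}, A l a b c d →
    ∀ {k q : ℕ} (h : (k, q) ∈ Θ) (f : Fin k → Fin l),
      HoldsP h a (fun j => b (f j)) → HoldsP h c (fun j => d (f j))
  back : ∀ {l : ℕ} {a : M} {b : Fin l → M} {c : N} {d : Fin l → N}, A l a b c d →
    ∀ c' : N, HoldsR Θ c c' →
      ∃ a' : M, HoldsR Θ a a' ∧ B l c' d a' b ∧ A l a' b c' d
  forthObject : ∀ {l : ℕ} {a : M} {b : Fin l → M} {c : N} {d : Fin l → N}, A l a b c d →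
    ∀ b' : M, HoldsE Θ a b' →
      ∃ d' : N, HoldsE Θ c d' ∧
        A (l + 1) a (Fin.snoc (α := fun _ => M) b b') c (Fin.snoc (α := fun _ => N) d d')
  backObject : ∀ {l : ℕ} {a : M} {b : Fin l → M} {c : N} {d : Fin l → N}, A l a b c d →
    ∀ c' d' : N, HoldsR Θ c c' → HoldsE Θ c' d' →
      ∃ a' b' : M, HoldsR Θ a a' ∧ HoldsE Θ a' b' ∧
        A (l + 1) a' (Fin.snoc (α := fun _ => M) b b') c' (Fin.snoc (α := fun _ => N) d d')

/-- `(A, B)` is an asimulation from the evaluation `Θ`-point `(M, a, b₁, …, bₙ)` to the evaluation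
`Θ`-point `(N, c, d₁, …, dₙ)`. -/
structure IsAsimulation (Θ : Set (ℕ × ℕ)) {M N : Type u} [(Voc Θ).Structure M]
    [(Voc Θ).Structure N] {n : ℕ} (a : M) (b : Fin n → M) (c : N) (d : Fin n → N)
    (A : TupleRel M N) (B : TupleRel N M) : Prop where
  base : A n a b c d
  left : AsimConditions Θ A B
  right : AsimConditions Θ B A

end Asimulation

/-- `φ(x, w₁, …, wₙ)` is invariant with respect to asimulations: for every vocabulary `Θ` that
contains the letters of `φ` (equivalently, `φ` is the image of a `Θ`-formula `ψ` under the
inclusion of `Θ` in `Σ`), and all evaluation `Θ`-points such that an asimulation leads from the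
first to the second, if `φ` is true at the first then it is true at the second. -/
def InvariantUnderAsimulations {n : ℕ} (φ : FullVoc.Formula (Fin (n + 1))) : Prop :=
  ∀ (Θ : Set (ℕ × ℕ)) (ψ : (Voc Θ).Formula (Fin (n + 1))), (incl Θ).onFormula ψ = φ →
    ∀ (M N : Type u) [(Voc Θ).Structure M] [(Voc Θ).Structure N]
      (a : M) (b : Fin n → M) (c : N) (d : Fin n → N),
      (∃ (A : TupleRel M N) (B : TupleRel N M), IsAsimulation Θ a b c d A B) →
      ψ.Realize (Fin.cons a b : Fin (n + 1) → M) → ψ.Realize (Fin.cons c d : Fin (n + 1) → N)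

end Asim

/-! Asimulations preserve standard translations by induction on the formula: the clauses for atoms,
`→`, `∃` and `∀` are exactly what the induction asks for (`AsimConditions.forces`). For the
converse, suppose φ is equivalent to no translation, and let C be the set of its intuitionistic
consequences. Then ¬φ together with C is finitely satisfiable, since otherwise a finite conjunction
from C would be equivalent to φ. So it holds at some point (N; c, d). Next, φ together with the
negations of all intuitionistic formulas false at (c, d) is finitely satisfiable, since otherwise a
finite disjunction of those formulas would lie in C and be true at (c, d). So φ holds at a point (M;
a, b) whose intuitionistic type is included in that of (c, d). Both models can be taken to be
ultraproducts over ℕ, hence saturated for countable types (`exists_saturated_model`), and between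
saturated models type inclusion is an asimulation (`Saturated.asimConditions`). Invariance now makes
φ true at (c, d), a contradiction. -/

namespace Asim

open Filter FirstOrder FirstOrder.Language

/-! ### Countable saturation of ultraproducts -/

section Saturation

variable {L : FirstOrder.Language.{0, 0}}

/-- A structure in which every type in countably many variables over countably many parameters
that is finitely satisfiable is realized. -/
def Saturated (L : FirstOrder.Language.{0, 0}) (M : Type u) [L.Structure M] : Prop :=
  ∀ (α β : Type) [Countable α] [Countable β] (w : α → M) (Γ : Set (L.Formula (α ⊕ β))),
    (∀ Γ₀ ⊆ Γ, Γ₀.Finite → ∃ y : β → M, ∀ θ ∈ Γ₀, θ.Realize (Sum.elim w y)) →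
      ∃ y : β → M, ∀ θ ∈ Γ, θ.Realize (Sum.elim w y)

/-- The finitely many elements of `Γ` whose code is below `k`. -/
def initialPart {F : Type*} (e : F → ℕ) (Γ : Set F) (k : ℕ) : Set F :=
  {θ ∈ Γ | e θ < k}

theorem initialPart_subset {F : Type*} (e : F → ℕ) (Γ : Set F) (k : ℕ) :
    initialPart e Γ k ⊆ Γ :=
  fun _ h => h.1

theorem finite_initialPart {F : Type*} {e : F → ℕ} (he : e.Injective) (Γ : Set F) (k : ℕ) :
    (initialPart e Γ k).Finite :=
  ((Set.finite_Iio k).preimage he.injOn).subset fun _ h => h.2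

/-- A diagonal argument: in the `k`-th factor, realize as long an initial part of `Γ` as possible,
up to length `k`. By Łoś, each initial part is realizable in almost all factors, so the chosen
tuples satisfy each formula of `Γ` almost everywhere. -/
theorem saturated_ultraproduct [Countable L.Symbols] (M : ℕ → Type u) [∀ k, L.Structure (M k)]
    [∀ k, Nonempty (M k)] :
    Saturated L ((hyperfilter ℕ : Filter ℕ).Product M) := by
  classical
  intro α β _ _ w Γ hΓ
  obtain ⟨e, he⟩ := exists_injective_nat (L.Formula (α ⊕ β))
  obtain ⟨x, rfl⟩ : ∃ x : α → ∀ k, M k,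
      w = fun i => (x i : (hyperfilter ℕ : Filter ℕ).Product M) :=
    ⟨fun i => Quotient.out (w i), funext fun i => (Quotient.out_eq (w i)).symm⟩
  have los (y : β → ∀ k, M k) (θ : L.Formula (α ⊕ β)) :
      θ.Realize (Sum.elim (fun i => (x i : (hyperfilter ℕ : Filter ℕ).Product M))
        (fun i => (y i : (hyperfilter ℕ : Filter ℕ).Product M))) ↔
      ∀ᶠ k in (hyperfilter ℕ : Filter ℕ),
        θ.Realize (Sum.elim (fun i => x i k) (fun i => y i k)) := by
    have h1 : Sum.elim (fun i => (x i : (hyperfilter ℕ : Filter ℕ).Product M))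
        (fun i => (y i : (hyperfilter ℕ : Filter ℕ).Product M)) =
        fun s => ((Sum.elim x y s : ∀ k, M k) : (hyperfilter ℕ : Filter ℕ).Product M) := by
      funext s; cases s <;> rfl
    have h2 (k : ℕ) : Sum.elim (fun i => x i k) (fun i => y i k) = fun s => Sum.elim x y s k := by
      funext s; cases s <;> rfl
    simp_rw [h1, h2]
    exact Ultraproduct.realize_formula_cast θ _
  let S (n k : ℕ) : Prop := ∃ y : β → M k, ∀ θ ∈ initialPart e Γ n,
    θ.Realize (Sum.elim (fun i => x i k) y)
  have hS (n : ℕ) : ∀ᶠ k in (hyperfilter ℕ : Filter ℕ), S n k := by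
    obtain ⟨y, hy⟩ := hΓ _ (initialPart_subset e Γ n) (finite_initialPart he Γ n)
    obtain ⟨z, rfl⟩ : ∃ z : β → ∀ k, M k,
        y = fun i => (z i : (hyperfilter ℕ : Filter ℕ).Product M) :=
      ⟨fun i => Quotient.out (y i), funext fun i => (Quotient.out_eq (y i)).symm⟩
    have := ((finite_initialPart he Γ n).eventually_all (l := (hyperfilter ℕ : Filter ℕ))).2
      fun θ hθ => (los z θ).1 (hy θ hθ)
    exact this.mono fun k hk => ⟨_, hk⟩
  have hS0 (k : ℕ) : S 0 k :=
    ⟨fun _ => Classical.arbitrary _, fun θ hθ => absurd hθ.2 (Nat.not_lt_zero _)⟩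
  -- The bound `k` ensures a greatest `n` even where all of `Γ` is realizable; it costs nothing, as
  -- the nonprincipal ultrafilter contains every tail of ℕ.
  have hmax (k : ℕ) : S (Nat.findGreatest (fun n => S n k) k) k :=
    Nat.findGreatest_spec (P := fun n => S n k) (Nat.zero_le k) (hS0 k)
  choose y hy using hmax
  refine ⟨fun i => ((fun k => y k i : ∀ k, M k) : (hyperfilter ℕ : Filter ℕ).Product M),
    fun θ hθ => (los (fun i k => y k i) θ).2 ?_⟩
  have hge : ∀ᶠ k in (hyperfilter ℕ : Filter ℕ), e θ + 1 ≤ k :=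
    Nat.hyperfilter_le_atTop (eventually_ge_atTop _)
  filter_upwards [hS (e θ + 1), hge] with k hk hk'
  exact hy k θ ⟨hθ, Nat.le_findGreatest hk' hk⟩

/-- Compactness, with a saturated model. -/
theorem exists_saturated_model [Countable L.Symbols] {β : Type} [Countable β]
    (Γ : Set (L.Formula β))
    (hΓ : ∀ Γ₀ ⊆ Γ, Γ₀.Finite → ∃ (M : Type u) (_ : L.Structure M) (_ : Nonempty M) (y : β → M),
      ∀ θ ∈ Γ₀, θ.Realize y) :
    ∃ (M : Type u) (_ : L.Structure M) (y : β → M),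
      Saturated L M ∧ ∀ θ ∈ Γ, θ.Realize y := by
  obtain ⟨e, he⟩ := exists_injective_nat (L.Formula β)
  choose M hM hne y hy using
    fun n => hΓ _ (initialPart_subset e Γ n) (finite_initialPart he Γ n)
  refine ⟨(hyperfilter ℕ : Filter ℕ).Product M, inferInstance,
    fun i => ((fun k => y k i : ∀ k, M k) : (hyperfilter ℕ : Filter ℕ).Product M),
    saturated_ultraproduct M, fun θ hθ => (Ultraproduct.realize_formula_cast θ _).2 ?_⟩
  have hge : ∀ᶠ k in (hyperfilter ℕ : Filter ℕ), e θ + 1 ≤ k :=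
    Nat.hyperfilter_le_atTop (eventually_ge_atTop _)
  exact hge.mono fun k hk => hy k θ ⟨hθ, hk⟩

end Saturation

/-- Needed to enumerate formulas in the saturation argument. -/
instance : Countable FullVoc.Symbols := by
  have h (k : ℕ) : Countable (Letter Set.univ k) := by
    let f : Letter Set.univ k → Option (Option (ℕ × ℕ)) := fun r =>
      match r with
      | .R => none
      | .E => some none
      | .P k m _ => some (some (k, m))
    refine Function.Injective.countable (f := f) fun r s hrs => ?_
    cases r <;> cases s <;> simp_all [f]
  have : Countable (Σ l, FullVoc.Functions l) :=
    inferInstanceAs (Countable (Σ _ : ℕ, Empty))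
  have : Countable (Σ l, FullVoc.Relations l) :=
    inferInstanceAs (Countable (Σ l, Letter Set.univ l))
  exact inferInstanceAs (Countable ((Σ l, FullVoc.Functions l) ⊕ (Σ l, FullVoc.Relations l)))

/-! ### Semantics of the standard translation, and type inclusion as an asimulation -/

section Forcing

variable {I : ℕ → Type v} (tr : ∀ k, I k → ℕ)

/-- The truth of `ST(i, x)` at an evaluation point. -/
def Forces {M : Type u} [FullVoc.Structure M] : ∀ {n : ℕ}, IFormula I n → M → (Fin n → M) → Prop
  | _, .atom (k := k) p t, a, b => HoldsP (Set.mem_univ (k, tr k p)) a (fun j => b (t j))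
  | _, .bot, _, _ => False
  | _, .and i j, a, b => Forces i a b ∧ Forces j a b
  | _, .or i j, a, b => Forces i a b ∨ Forces j a b
  | _, .imp i j, a, b => ∀ a', HoldsR Set.univ a a' → Forces i a' b → Forces j a' b
  | n, .ex i, a, b => ∃ b', HoldsE Set.univ a b' ∧
      Forces i a (Fin.snoc (α := fun _ : Fin (n + 1) => M) b b')
  | n, .all i, a, b => ∀ a' b', HoldsR Set.univ a a' → HoldsE Set.univ a' b' →
      Forces i a' (Fin.snoc (α := fun _ : Fin (n + 1) => M) b b')

section Realize

variable {α : Type} {M : Type u} {m : ℕ}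

theorem elim_snoc_up (v : α → M) (xs : Fin m → M) (a : M) (s : α ⊕ Fin m) :
    Sum.elim v (Fin.snoc (α := fun _ => M) xs a) (up s) = Sum.elim v xs s := by
  cases s <;> simp [up]

theorem elim_snoc_new (v : α → M) (xs : Fin m → M) (a : M) :
    Sum.elim v (Fin.snoc (α := fun _ => M) xs a) new = a := by
  simp [new]

variable [FullVoc.Structure M]

theorem realize_relR (s t : α ⊕ Fin m) (v : α → M) (xs : Fin m → M) :
    (relR s t).Realize v xs ↔ HoldsR Set.univ (Sum.elim v xs s) (Sum.elim v xs t) :=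
  BoundedFormula.realize_rel₂

theorem realize_relE (s t : α ⊕ Fin m) (v : α → M) (xs : Fin m → M) :
    (relE s t).Realize v xs ↔ HoldsE Set.univ (Sum.elim v xs s) (Sum.elim v xs t) :=
  BoundedFormula.realize_rel₂

theorem realize_relP (k q : ℕ) (s : α ⊕ Fin m) (t : Fin k → α ⊕ Fin m) (v : α → M)
    (xs : Fin m → M) :
    (relP k q s t).Realize v xs ↔
      HoldsP (Set.mem_univ (k, q)) (Sum.elim v xs s) (fun j => Sum.elim v xs (t j)) := by
  refine BoundedFormula.realize_rel.trans (iff_of_eq ?_)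
  unfold HoldsP
  congr 1
  funext j
  refine Fin.cases ?_ (fun j => ?_) j <;> simp

theorem realize_ST {n : ℕ} (i : IFormula I n) :
    ∀ {m : ℕ} (x : α ⊕ Fin m) (w : Fin n → α ⊕ Fin m) (v : α → M) (xs : Fin m → M),
      (ST tr i x w).Realize v xs ↔
        Forces tr i (Sum.elim v xs x) (fun l => Sum.elim v xs (w l)) := by
  have snoc_eq {n m : ℕ} (w : Fin n → α ⊕ Fin m) (s : α ⊕ Fin m) (v : α → M) (xs : Fin m → M) :
      (fun l => Sum.elim v xs (Fin.snoc (α := fun _ : Fin (n + 1) => α ⊕ Fin m) w s l)) =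
        Fin.snoc (α := fun _ => M) (fun l => Sum.elim v xs (w l)) (Sum.elim v xs s) := by
    funext l
    refine Fin.lastCases ?_ (fun l => ?_) l <;> simp
  induction i with
  | atom p t => intro m x w v xs; exact realize_relP _ _ _ _ _ _
  | bot => intro m x w v xs; simp [ST, Forces]
  | and i j hi hj => intro m x w v xs; simp [ST, Forces, hi, hj]
  | or i j hi hj => intro m x w v xs; simp [ST, Forces, hi, hj]
  | imp i j hi hj =>
    intro m x w v xs
    simp [ST, Forces, hi, hj, realize_relR, elim_snoc_up, elim_snoc_new]
  | ex i hi =>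
    intro m x w v xs
    simp [ST, Forces, hi, realize_relE, elim_snoc_up, elim_snoc_new, snoc_eq]
  | all i hi =>
    intro m x w v xs
    simp [ST, Forces, hi, realize_relE, realize_relR, elim_snoc_up, elim_snoc_new, snoc_eq]

theorem realize_stdTranslation {n : ℕ} (i : IFormula I n) (a : M) (b : Fin n → M) :
    (stdTranslation tr i).Realize (Fin.cons a b : Fin (n + 1) → M) ↔ Forces tr i a b :=
  realize_ST tr i _ _ _ _

end Realize

/-- The conjunction of a list of formulas. -/
def conj {n : ℕ} (ps : List (IFormula I n)) : IFormula I n :=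
  -- There is no primitive `⊤`; `⊥ → ⊥` serves as the empty conjunction.
  ps.foldr .and (.imp .bot .bot)

/-- The disjunction of a list of formulas. -/
def disj {n : ℕ} (qs : List (IFormula I n)) : IFormula I n :=
  qs.foldr .or .bot

variable {M : Type u} [FullVoc.Structure M]

theorem forces_conj {n : ℕ} (ps : List (IFormula I n)) (a : M) (b : Fin n → M) :
    Forces tr (conj ps) a b ↔ ∀ p ∈ ps, Forces tr p a b := by
  induction ps with
  | nil => simp [conj, Forces]
  | cons p ps ih =>
    rw [List.forall_mem_cons, ← ih]
    exact Iff.rfl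

theorem forces_disj {n : ℕ} (qs : List (IFormula I n)) (a : M) (b : Fin n → M) :
    Forces tr (disj qs) a b ↔ ∃ q ∈ qs, Forces tr q a b := by
  induction qs with
  | nil => simp [disj, Forces]
  | cons q qs ih =>
    rw [List.exists_mem_cons_iff, ← ih]
    exact Iff.rfl

/-- Asimulations preserve the truth of intuitionistic formulas. -/
theorem AsimConditions.forces {n : ℕ} (i : IFormula I n) :
    ∀ {M N : Type u} [FullVoc.Structure M] [FullVoc.Structure N] {A : TupleRel M N}
      {B : TupleRel N M}, AsimConditions Set.univ A B → AsimConditions Set.univ B A →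
      ∀ {a : M} {b : Fin n → M} {c : N} {d : Fin n → N}, A n a b c d →
        Forces tr i a b → Forces tr i c d := by
  induction i with
  | atom p t => intro M N _ _ A B hA hB a b c d h; exact hA.atoms h _ t
  | bot => intro M N _ _ A B hA hB a b c d h; exact id
  | and i j hi hj =>
    intro M N _ _ A B hA hB a b c d h
    exact And.imp (hi hA hB h) (hj hA hB h)
  | or i j hi hj =>
    intro M N _ _ A B hA hB a b c d h
    exact Or.imp (hi hA hB h) (hj hA hB h)
  | imp i j hi hj =>
    intro M N _ _ A B hA hB a b c d h hf c' hc hic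
    -- The antecedent travels from `c'` to `a'` along `B`, the consequent back along `A`; hence the
    -- induction is over both directions at once.
    obtain ⟨a', ha, hBa, hAa⟩ := hA.back h c' hc
    exact hj hA hB hAa (hf a' ha (hi hB hA hBa hic))
  | ex i hi =>
    rintro M N _ _ A B hA hB a b c d h ⟨b', hb, hf⟩
    obtain ⟨d', hd, h'⟩ := hA.forthObject h b' hb
    exact ⟨d', hd, hi hA hB h' hf⟩
  | all i hi =>
    intro M N _ _ A B hA hB a b c d h hf c' d' hc hd
    obtain ⟨a', b', ha, hb, h'⟩ := hA.backObject h c' d' hc hd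
    exact hi hA hB h' (hf a' b' ha hb)

/-- The type that consists of `ρ`, the formulas `f p` for `p ∈ P` and the negations of the
formulas `f q` for `q ∈ Q`. -/
def signedType {α J : Type*} (ρ : FullVoc.Formula α) (f : J → FullVoc.Formula α) (P Q : Set J) :
    Set (FullVoc.Formula α) :=
  insert ρ (f '' P ∪ (fun q => ∼(f q)) '' Q)

theorem realize_signedType {α J : Type*} {ρ : FullVoc.Formula α} {f : J → FullVoc.Formula α}
    {P Q : Set J} {v : α → M} :
    (∀ θ ∈ signedType ρ f P Q, θ.Realize v) ↔
      ρ.Realize v ∧ (∀ p ∈ P, (f p).Realize v) ∧ ∀ q ∈ Q, ¬(f q).Realize v := by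
  simp only [signedType, Set.forall_mem_insert, Set.mem_union, or_imp, forall_and,
    Set.forall_mem_image, Formula.realize_not]

theorem exists_lists_of_finite_subset_signedType {α J : Type*} {ρ : FullVoc.Formula α}
    {f : J → FullVoc.Formula α} {P Q : Set J} {Γ : Set (FullVoc.Formula α)}
    (hΓ : Γ ⊆ signedType ρ f P Q) (hfin : Γ.Finite) :
    ∃ ps qs : List J, (∀ p ∈ ps, p ∈ P) ∧ (∀ q ∈ qs, q ∈ Q) ∧
      Γ ⊆ signedType ρ f {p | p ∈ ps} {q | q ∈ qs} := by
  induction Γ, hfin using Set.Finite.induction_on with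
  | empty => exact ⟨[], [], by simp, by simp, Set.empty_subset _⟩
  | @insert θ Γ _ _ ih =>
    rw [Set.insert_subset_iff] at hΓ
    obtain ⟨ps, qs, hps, hqs, h⟩ := ih hΓ.2
    rcases hΓ.1 with rfl | ⟨p, hp, rfl⟩ | ⟨q, hq, rfl⟩
    · exact ⟨ps, qs, hps, hqs, Set.insert_subset (Or.inl rfl) h⟩
    · refine ⟨p :: ps, qs, by simpa using ⟨hp, hps⟩, hqs, Set.insert_subset
        (Or.inr (Or.inl ⟨p, by simp, rfl⟩)) (h.trans (Set.insert_subset_insert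
          (Set.union_subset_union_left _ (Set.image_mono fun r hr => ?_))))⟩
      exact List.mem_cons_of_mem _ hr
    · refine ⟨ps, q :: qs, hps, by simpa using ⟨hq, hqs⟩, Set.insert_subset
        (Or.inr (Or.inr ⟨q, by simp, rfl⟩)) (h.trans (Set.insert_subset_insert
          (Set.union_subset_union_right _ (Set.image_mono fun r hr => ?_))))⟩
      exact List.mem_cons_of_mem _ hr

/-- Saturation, for types made of one first-order formula `ρ` and of intuitionistic formulas that
are to be true or false. -/
theorem Saturated.exists_forces (hM : Saturated FullVoc M) {α β : Type} [Countable α] [Countable β]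
    {n : ℕ} (v : α → M) (ρ : FullVoc.Formula (α ⊕ β)) (x : α ⊕ β) (w : Fin n → α ⊕ β)
    (P Q : Set (IFormula I n))
    (h : ∀ ps qs : List (IFormula I n), (∀ p ∈ ps, p ∈ P) → (∀ q ∈ qs, q ∈ Q) →
      ∃ y : β → M, ρ.Realize (Sum.elim v y) ∧
        Forces tr (conj ps) (Sum.elim v y x) (fun l => Sum.elim v y (w l)) ∧
        ¬Forces tr (disj qs) (Sum.elim v y x) (fun l => Sum.elim v y (w l))) :
    ∃ y : β → M, ρ.Realize (Sum.elim v y) ∧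
      (∀ p ∈ P, Forces tr p (Sum.elim v y x) (fun l => Sum.elim v y (w l))) ∧
      ∀ q ∈ Q, ¬Forces tr q (Sum.elim v y x) (fun l => Sum.elim v y (w l)) := by
  let f (i : IFormula I n) : FullVoc.Formula (α ⊕ β) :=
    ST tr (m := 0) i (Sum.inl x) (fun l => Sum.inl (w l))
  have hf (i : IFormula I n) (u : α ⊕ β → M) :
      (f i).Realize u ↔ Forces tr i (u x) (fun l => u (w l)) :=
    realize_ST tr i _ _ _ _
  obtain ⟨y, hy⟩ := hM α β v (signedType ρ f P Q) fun Γ hΓ hfin => by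
    obtain ⟨ps, qs, hps, hqs, hsub⟩ := exists_lists_of_finite_subset_signedType hΓ hfin
    obtain ⟨y, h1, h2, h3⟩ := h ps qs hps hqs
    rw [forces_conj] at h2
    rw [forces_disj] at h3
    push Not at h3
    exact ⟨y, fun θ hθ => realize_signedType.2 ⟨h1, fun p hp => (hf _ _).2 (h2 p hp),
      fun q hq hr => h3 q hq ((hf _ _).1 hr)⟩ θ (hsub hθ)⟩
  obtain ⟨h1, h2, h3⟩ := realize_signedType.1 hy
  exact ⟨y, h1, fun p hp => (hf _ _).1 (h2 p hp), fun q hq hr => h3 q hq ((hf _ _).2 hr)⟩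

/-- Compactness, for types made of one first-order formula `ρ` and of standard translations that
are to be true or false. -/
theorem exists_saturated_model_forces {n : ℕ} (ρ : FullVoc.Formula (Fin (n + 1)))
    (P Q : Set (IFormula I n))
    (h : ∀ ps qs : List (IFormula I n), (∀ p ∈ ps, p ∈ P) → (∀ q ∈ qs, q ∈ Q) →
      ∃ (M : Type u) (_ : FullVoc.Structure M) (a : M) (b : Fin n → M),
        ρ.Realize (Fin.cons a b : Fin (n + 1) → M) ∧ Forces tr (conj ps) a b ∧
          ¬Forces tr (disj qs) a b) :
    ∃ (M : Type u) (_ : FullVoc.Structure M) (a : M) (b : Fin n → M), Saturated FullVoc M ∧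
      ρ.Realize (Fin.cons a b : Fin (n + 1) → M) ∧ (∀ p ∈ P, Forces tr p a b) ∧
        ∀ q ∈ Q, ¬Forces tr q a b := by
  obtain ⟨M, hM, y, hsat, hy⟩ := exists_saturated_model.{u}
      (signedType ρ (stdTranslation tr) P Q) fun Γ hΓ hfin => by
    obtain ⟨ps, qs, hps, hqs, hsub⟩ := exists_lists_of_finite_subset_signedType hΓ hfin
    obtain ⟨M, hM, a, b, h1, h2, h3⟩ := h ps qs hps hqs
    rw [forces_conj] at h2
    rw [forces_disj] at h3
    push Not at h3
    exact ⟨M, hM, ⟨a⟩, Fin.cons a b, fun θ hθ => realize_signedType.2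
      ⟨h1, fun p hp => (realize_stdTranslation tr _ _ _).2 (h2 p hp),
      fun q hq hr => h3 q hq ((realize_stdTranslation tr _ _ _).1 hr)⟩ θ (hsub hθ)⟩
  obtain ⟨a, b, rfl⟩ : ∃ (a : M) (b : Fin n → M), y = Fin.cons a b :=
    ⟨y 0, Fin.tail y, (Fin.cons_self_tail y).symm⟩
  obtain ⟨h1, h2, h3⟩ := realize_signedType.1 hy
  exact ⟨M, hM, a, b, hsat, h1, fun p hp => (realize_stdTranslation tr _ _ _).1 (h2 p hp),
    fun q hq hr => h3 q hq ((realize_stdTranslation tr _ _ _).2 hr)⟩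

/-- Inclusion of intuitionistic types. -/
def TypeInclusion (M N : Type u) [FullVoc.Structure M] [FullVoc.Structure N] : TupleRel M N :=
  fun l a b c d => ∀ i : IFormula I l, Forces tr i a b → Forces tr i c d

theorem elim_cons_snoc {M β : Type*} {l : ℕ} (a : M) (b : Fin l → M) (y : β → M) (t : β) :
    (fun j => Sum.elim (Fin.cons a b : Fin (l + 1) → M) y
      (Fin.snoc (α := fun _ : Fin (l + 1) => Fin (l + 1) ⊕ β) (fun j => Sum.inl j.succ)
        (Sum.inr t) j)) = Fin.snoc (α := fun _ => M) b (y t) := by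
  funext j
  refine Fin.lastCases ?_ (fun j => ?_) j <;> simp

/-- Between saturated models, inclusion of intuitionistic types is an asimulation. -/
theorem Saturated.asimConditions (htr : ∀ k, Function.Surjective (tr k)) {N : Type u}
    [FullVoc.Structure N] (hM : Saturated FullVoc M) (hN : Saturated FullVoc N) :
    AsimConditions Set.univ (TypeInclusion tr M N) (TypeInclusion tr N M) where
  atoms {l a b c d} h k q _ f := by
    obtain ⟨p, rfl⟩ := htr k q
    exact h (.atom p f)
  back {l a b c d} h c' hc := by
    obtain ⟨y, h1, h2, h3⟩ := hM.exists_forces tr (α := Fin (l + 1)) (β := Unit) (Fin.cons a b)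
      (relR (m := 0) (Sum.inl (Sum.inl 0)) (Sum.inl (Sum.inr ()))) (Sum.inr ())
      (fun j => Sum.inl j.succ) {i | Forces tr i c' d} {i | ¬Forces tr i c' d} fun ps qs hps hqs => by
        by_contra! hcon
        -- Without a suitable successor of `a`, this implication holds at `a`, hence at `c`, and it
        -- fails at `c'`.
        have := h (.imp (conj ps) (disj qs)) fun a' ha hp =>
          hcon (fun _ => a') ((realize_relR _ _ _ _).2 ha) hp
        obtain ⟨q, hq, hf⟩ := (forces_disj tr _ _ _).1
          (this c' hc ((forces_conj tr _ _ _).2 hps))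
        exact hqs q hq hf
    -- The true formulas give inclusion from `c'` to `a'`, the false ones the reverse inclusion.
    refine ⟨y (), (realize_relR _ _ _ _).1 h1, h2, fun i hi => ?_⟩
    by_contra hcon
    exact h3 i hcon hi
  forthObject {l a b c d} h b' hb := by
    obtain ⟨y, h1, h2, -⟩ := hN.exists_forces tr (α := Fin (l + 1)) (β := Unit) (Fin.cons c d)
      (relE (m := 0) (Sum.inl (Sum.inl 0)) (Sum.inl (Sum.inr ()))) (Sum.inl 0)
      (Fin.snoc (α := fun _ => Fin (l + 1) ⊕ Unit) (fun j => Sum.inl j.succ) (Sum.inr ()))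
      {i | Forces tr i a (Fin.snoc (α := fun _ => M) b b')} ∅ fun ps qs hps hqs => by
        obtain ⟨d', hd, hf⟩ := h (.ex (conj ps)) ⟨b', hb, (forces_conj tr _ _ _).2 hps⟩
        refine ⟨fun _ => d', (realize_relE _ _ _ _).2 hd, ?_, ?_⟩
        · rw [elim_cons_snoc]
          exact hf
        · rw [forces_disj]
          rintro ⟨q, hq, -⟩
          exact hqs q hq
    refine ⟨y (), (realize_relE _ _ _ _).1 h1, fun i hi => ?_⟩
    have := h2 i hi
    rwa [elim_cons_snoc] at this
  backObject {l a b c d} h c' d' hc hd := by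
    -- Two unknowns: `false` indexes the successor `a'`, `true` the object `b'`. Only inclusion
    -- towards `N` is required, so only falsity is prescribed.
    obtain ⟨y, h1, -, h3⟩ := hM.exists_forces tr (α := Fin (l + 1)) (β := Bool) (Fin.cons a b)
      (relR (m := 0) (Sum.inl (Sum.inl 0)) (Sum.inl (Sum.inr false)) ⊓
        relE (m := 0) (Sum.inl (Sum.inr false)) (Sum.inl (Sum.inr true))) (Sum.inr false)
      (Fin.snoc (α := fun _ => Fin (l + 1) ⊕ Bool) (fun j => Sum.inl j.succ) (Sum.inr true))
      ∅ {i | ¬Forces tr i c' (Fin.snoc (α := fun _ => N) d d')} fun ps qs hps hqs => by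
        by_contra! hcon
        have := h (.all (disj qs)) fun a' b' ha hb => by
          have := hcon (fun t => if t then b' else a') (BoundedFormula.realize_inf.2
            ⟨(realize_relR _ _ _ _).2 (by simpa using ha),
              (realize_relE _ _ _ _).2 (by simpa using hb)⟩)
            ((forces_conj tr _ _ _).2 fun p hp => (hps p hp).elim)
          rwa [elim_cons_snoc] at this
        obtain ⟨q, hq, hf⟩ := (forces_disj tr _ _ _).1 (this c' d' hc hd)
        exact hqs q hq hf
    obtain ⟨hR, hE⟩ := BoundedFormula.realize_inf.1 h1
    refine ⟨y false, y true, (realize_relR _ _ _ _).1 hR, (realize_relE _ _ _ _).1 hE,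
      fun i hi => ?_⟩
    by_contra hcon
    refine h3 i hcon ?_
    rw [elim_cons_snoc]
    exact hi

end Forcing

/-! ### Reduction to the full vocabulary -/

section Vocabularies

theorem incl_univ : incl Set.univ = LHom.id FullVoc := by
  refine LHom.funext rfl ?_
  funext k r
  cases r <;> rfl

theorem onFormula_incl_univ {α : Type*} (φ : FullVoc.Formula α) :
    (incl Set.univ).onFormula φ = φ := by
  rw [incl_univ]
  exact congrFun LHom.id_onBoundedFormula φ

open Classical in
/-- The expansion of a `Θ`-model in which the letters outside of `Θ` are false everywhere. -/
abbrev expansion (Θ : Set (ℕ × ℕ)) (M : Type u) [(Voc Θ).Structure M] : FullVoc.Structure M where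
  funMap := fun f => Empty.elim f
  RelMap := fun r x =>
    match r, x with
    | .R, x => Structure.RelMap (L := Voc Θ) Letter.R x
    | .E, x => Structure.RelMap (L := Voc Θ) Letter.E x
    | .P k m _, x => ∃ h : (k, m) ∈ Θ, Structure.RelMap (L := Voc Θ) (Letter.P k m h) x

theorem isExpansionOn_expansion (Θ : Set (ℕ × ℕ)) (M : Type u) [(Voc Θ).Structure M] :
    let := expansion Θ M
    (incl Θ).IsExpansionOn M := by
  let := expansion Θ M
  refine ⟨fun f => Empty.elim f, fun {k} r x => ?_⟩
  cases r with
  | R => rfl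
  | E => rfl
  | P k m h => exact propext ⟨fun ⟨_, h⟩ => h, fun h' => ⟨h, h'⟩⟩

/-- Atoms with letters outside `Θ` are never true in the expansion, so their preservation is
vacuous. -/
theorem AsimConditions.expansion {Θ : Set (ℕ × ℕ)} {M N : Type u} [(Voc Θ).Structure M]
    [(Voc Θ).Structure N] {A : TupleRel M N} {B : TupleRel N M} (hA : AsimConditions Θ A B) :
    let := expansion Θ M
    let := Asim.expansion Θ N
    AsimConditions Set.univ A B :=
  let := Asim.expansion Θ M
  let := Asim.expansion Θ N
  { atoms := fun h _ _ _ f ⟨hP, hp⟩ => ⟨hP, hA.atoms h hP f hp⟩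
    back := hA.back
    forthObject := hA.forthObject
    backObject := hA.backObject }

end Vocabularies

/-- Equivalence over all models in a given universe is logical equivalence. -/
theorem iff_of_forall_realize {α : Type} {φ ψ : FullVoc.Formula α}
    (h : ∀ (M : Type u) [FullVoc.Structure M] (v : α → M), φ.Realize v ↔ ψ.Realize v) :
    (∅ : FullVoc.Theory).Iff φ ψ := by
  intro M v xs
  rw [BoundedFormula.realize_iff]
  -- `Theory.Iff` tests models in `Type` here, so they are copied into universe `u`.
  let e : M ≃ ULift.{u} M := Equiv.ulift.symm
  let : FullVoc.Structure (ULift.{u} M) := e.inducedStructure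
  have key (θ : FullVoc.Formula α) : θ.Realize (e ∘ v) ↔ BoundedFormula.Realize θ v xs := by
    rw [Subsingleton.elim xs default]
    exact StrongHomClass.realize_formula e.inducedStructureEquiv θ
  rw [← key, ← key]
  exact h _ _

/-! ### The two directions of the theorem -/

theorem invariantUnderAsimulations_of_iff {I : ℕ → Type v} {tr : ∀ k : ℕ, I k → ℕ} {n : ℕ}
    {φ : FullVoc.Formula (Fin (n + 1))} {i : IFormula I n}
    (h : (∅ : FullVoc.Theory).Iff φ (stdTranslation tr i)) :
    InvariantUnderAsimulations.{u} φ := by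
  rintro Θ ψ rfl M N _ _ a b c d ⟨A, B, hAB⟩ hψ
  let := expansion Θ M
  let := expansion Θ N
  have := isExpansionOn_expansion Θ M
  have := isExpansionOn_expansion Θ N
  have : Nonempty M := ⟨a⟩
  have : Nonempty N := ⟨c⟩
  rw [← LHom.realize_onFormula (M := M) (incl Θ) ψ, h.realize_iff, realize_stdTranslation] at hψ
  rw [← LHom.realize_onFormula (M := N) (incl Θ) ψ, h.realize_iff, realize_stdTranslation]
  exact AsimConditions.forces tr i hAB.left.expansion hAB.right.expansion hAB.base hψ

theorem InvariantUnderAsimulations.exists_iff {I : ℕ → Type v} {tr : ∀ k : ℕ, I k → ℕ}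
    (htr : ∀ k : ℕ, Function.Surjective (tr k)) {n : ℕ} {φ : FullVoc.Formula (Fin (n + 1))}
    (hφ : InvariantUnderAsimulations.{u} φ) :
    ∃ i : IFormula I n, (∅ : FullVoc.Theory).Iff φ (stdTranslation tr i) := by
  by_contra hcon
  let C : Set (IFormula I n) := {i | ∀ (M : Type u) [FullVoc.Structure M] (a : M) (b : Fin n → M),
    φ.Realize (Fin.cons a b : Fin (n + 1) → M) → Forces tr i a b}
  obtain ⟨N, _, c, d, hN, hnot, hC, -⟩ :=
      exists_saturated_model_forces.{u} tr (∼φ) C ∅ fun ps qs hps hqs => by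
    by_contra hno
    -- If `¬φ` were inconsistent with `ps`, then `conj ps` would imply φ, and φ implies each member
    -- of `ps`.
    refine hcon ⟨conj ps, iff_of_forall_realize.{u} fun M _ v => ?_⟩
    obtain ⟨a, b, rfl⟩ : ∃ (a : M) (b : Fin n → M), v = Fin.cons a b :=
      ⟨v 0, Fin.tail v, (Fin.cons_self_tail v).symm⟩
    rw [realize_stdTranslation]
    refine ⟨fun h => (forces_conj tr _ _ _).2 fun p hp => hps p hp M a b h, fun h => ?_⟩
    by_contra hn
    refine hno ⟨M, _, a, b, hn, h, ?_⟩
    rw [forces_disj]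
    rintro ⟨q, hq, -⟩
    exact hqs q hq
  obtain ⟨M, _, a, b, hM, hreal, -, hQ⟩ :=
      exists_saturated_model_forces.{u} tr φ ∅ {i | ¬Forces tr i c d} fun ps qs hps hqs => by
    by_contra hno
    have hmem : disj qs ∈ C := by
      intro M _ a b h
      by_contra hn
      exact hno ⟨M, _, a, b, h, (forces_conj tr _ _ _).2 fun p hp => (hps p hp).elim, hn⟩
    obtain ⟨q, hq, hf⟩ := (forces_disj tr _ _ _).1 (hC _ hmem)
    exact hqs q hq hf
  refine hnot (hφ Set.univ φ (onFormula_incl_univ φ) M N a b c d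
    ⟨TypeInclusion tr M N, TypeInclusion tr N M, fun i hi => ?_,
      hM.asimConditions tr htr hN, hN.asimConditions tr htr hM⟩ hreal)
  by_contra hn
  exact hQ i hn hi

end Asim

theorem mainTheorem1 {I : ℕ → Type v} (tr : ∀ k : ℕ, I k → ℕ)
    (htr : ∀ k : ℕ, Function.Surjective (tr k)) (n : ℕ)
    (φ : Asim.FullVoc.Formula (Fin (n + 1))) :
    Asim.InvariantUnderAsimulations.{u} φ ↔
      ∃ i : Asim.IFormula I n,
        (∅ : Asim.FullVoc.Theory).Iff φ (Asim.stdTranslation tr i) :=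
  ⟨fun h => h.exists_iff htr, fun ⟨_, h⟩ => Asim.invariantUnderAsimulations_of_iff h⟩
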